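/- For integers $m,N\ge 1$ let $I=\{-N,\dots,N\}^m$, and for $b\in I$ let $K^m(N,b)=\operatorname{conv}\{x\in\mathbb Z_{\ge 0}^I:\sum_{v\in I}x_v v=b\}$ be the master equality polyhedron. Its polaroid is the polyhedron of all $\pi\in\mathbb R^I$ (standing for the inequalities $\sum_{v\in I}\pi_v x_v\ge 1$) that satisfy - $\pi_b=1$; - complementarity: $\pi_u+\pi_{b-u}=1$ whenever $u\in I$ and $b-u\in I$; - subadditivity: $\pi_{v_1}+\dots+\pi_{v_t}\ge \pi_{v_1+\dots+v_t}$ for all $t\ge 1$ and all $v_1,\dots,v_t\in I$ (not necessarily distinct) with $v_1+\dots+v_t\in I$. Let $k^*(m)\in\mathbb N\cup\{\infty\}$ be the least $k$ such that, for all $N\ge 1$ and all $b\in I$, the first two groups of constraints together with the subadditivity constraints with $t\le k$ terms imply all the subadditivity constraints. Equivalently, $k^*(m)$ is the largest number of terms in a subadditivity constraint, over all $N$ and $b$, that does not follow from the first two groups of constraints and the subadditivity constraints with fewer terms. **Corollary.** There is a constant $c>0$ such that $k^*(m)\ge (cm)^{m/4}$ for all even $m\ge 2$. -/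

import Mathlib

open scoped ENNReal

/-- The index set `I = {-N, …, N}^m` of the master equality polyhedron `K^m(N, b)`. -/
def indexBox (m N : ℕ) : Set (Fin m → ℤ) :=
  {v | ∀ i, |v i| ≤ (N : ℤ)}

/-- The subadditivity constraints with exactly `t` terms on `π ∈ ℝ^I`:
`π_{v₁} + ⋯ + π_{v_t} ≥ π_{v₁ + ⋯ + v_t}` for all `v₁, …, v_t ∈ I` (repetitions allowed)
whose sum lies in `I`. -/
def SubadditiveTerms {m N : ℕ} (t : ℕ) (π : indexBox m N → ℝ) : Prop :=
  ∀ (v : Fin t → indexBox m N) (s : indexBox m N),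
    (s : Fin m → ℤ) = ∑ i, (v i : Fin m → ℤ) → π s ≤ ∑ i, π (v i)

/-- The polyhedron in `ℝ^I` cut out by the normalization `π_b = 1`, the complementarity
equations `π_u + π_{b - u} = 1` (whenever `u` and `b - u` both lie in `I`), and the
subadditivity constraints with at most `k` terms.  A point `π` of it stands for the
inequality `∑ π_v x_v ≥ 1`. -/
def truncatedPolaroid (m N : ℕ) (b : indexBox m N) (k : ℕ) : Set (indexBox m N → ℝ) :=
  {π | π b = 1 ∧
    (∀ u w : indexBox m N, (u : Fin m → ℤ) + (w : Fin m → ℤ) = (b : Fin m → ℤ) →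
      π u + π w = 1) ∧
    ∀ t : ℕ, 1 ≤ t → t ≤ k → SubadditiveTerms t π}

/-- The polaroid of `K^m(N, b)`: as above, with the subadditivity constraints of every length. -/
def polaroid (m N : ℕ) (b : indexBox m N) : Set (indexBox m N → ℝ) :=
  {π | ∀ k : ℕ, π ∈ truncatedPolaroid m N b k}

/-- `k` terms suffice in dimension `m` if, for every `N ≥ 1` and every right-hand side `b ∈ I`,
all subadditivity constraints with more than `k` terms are redundant in the description of
the polaroid of `K^m(N, b)`. -/
def TermsSuffice (m k : ℕ) : Prop :=
  ∀ N : ℕ, 1 ≤ N → ∀ b : indexBox m N, truncatedPolaroid m N b k = polaroid m N b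

/-- `k*(m)`: the least `k` such that `k` terms suffice in dimension `m`, equivalently the largest
number of terms of a subadditivity constraint that does not follow from the normalization, the
complementarity equations and the subadditivity constraints with fewer terms.
(The value would be `⊤` if no `k` sufficed.) -/
noncomputable def kStar (m : ℕ) : ℕ∞ :=
  ⨅ (k : ℕ) (_ : TermsSuffice m k), (k : ℕ∞)

/-! ### A separating point from a gap in the multiples of a family -/

section GapLemma

/-! Suppose `T` box vectors, with repetition, sum to `b` in the box, while no combination of between
2 and `T - 1` of them lies in the box and no `b - v u` does. Giving each of them the tiny weight `1
/ (2T)` violates a `T`-term constraint, and the other weights can be chosen so that no shorter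
constraint notices (`le_kStar_of_gap`).

Such vectors come from a minimal integer relation between the columns of a sign matrix: scaling by
`2T` and shifting by ±1 pushes every shorter combination out of the box
(`le_kStar_of_sign_relation`). It remains to find a sign matrix with `2^k - 1` rows and `2^k`
columns whose nonzero integer kernel vectors are all huge. Each large set `i` gets a row forcing the
Walsh coefficient at `i` to be about `2^(|i| - 1)` times that at the preceding large set
(`exists_sign_row`). These ratios multiply along the colexicographic order
(`walshTransform_growth`), and a Walsh coefficient never exceeds the ℓ¹ norm. -/

theorem le_kStar_of_forall_not_termsSuffice {m T : ℕ} (h : ∀ k < T, ¬ TermsSuffice m k) :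
    (T : ℕ∞) ≤ kStar m :=
  le_iInf₂ fun k hk => by
    by_contra hlt
    exact h k (by simpa using hlt) hk

theorem one_le_kStar {m : ℕ} (hm : 0 < m) : 1 ≤ kStar m := by
  have key : ¬ TermsSuffice m 0 := by
    intro hS
    have hb : (fun _ => 1 : Fin m → ℤ) ∈ indexBox m 1 := fun i => by simp
    have hb' : (fun _ => -1 : Fin m → ℤ) ∈ indexBox m 1 := fun i => by simp
    have h0 : (0 : Fin m → ℤ) ∈ indexBox m 1 := fun i => by simp
    let i₀ : Fin m := ⟨0, hm⟩
    -- For `b = (1, …, 1)` complementarity never involves a point with first coordinate -1, as its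
    -- partner would have coordinate 2. The value there is free, and -5 breaks the two-term
    -- constraint for `b + (-b) = 0`.
    let π : indexBox m 1 → ℝ := fun w => if w.1 i₀ = -1 then -5 else (w.1 i₀ : ℝ)
    have hπ : π ∈ truncatedPolaroid m 1 ⟨_, hb⟩ 0 := by
      refine ⟨by simp [π], fun u w huw => ?_, fun t h1 h2 => by omega⟩
      have h := congrFun huw i₀
      have hu := abs_le.1 (u.2 i₀)
      have hw := abs_le.1 (w.2 i₀)
      simp only [Pi.add_apply] at h
      have h1 : u.1 i₀ ≠ -1 := by push_cast at *; omega
      have h2 : w.1 i₀ ≠ -1 := by push_cast at *; omega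
      simp only [π, h1, h2, if_false]
      exact_mod_cast h
    rw [hS 1 le_rfl ⟨_, hb⟩] at hπ
    have := (hπ 2).2.2 2 (by norm_num) le_rfl ![⟨_, hb⟩, ⟨_, hb'⟩] ⟨0, h0⟩
      (by ext i; simp [Fin.sum_univ_two])
    norm_num [Fin.sum_univ_two, π] at this
  have h := le_kStar_of_forall_not_termsSuffice (m := m) (T := 1)
    (fun k hk => by obtain rfl : k = 0 := by omega
                    exact key)
  simpa using h

variable {m N : ℕ} {ι : Type*} [Fintype ι]

/-- The integer combination `∑ μ_u v_u` of a family of points. -/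
def comb (v : ι → Fin m → ℤ) (μ : ι → ℕ) : Fin m → ℤ := ∑ u, (μ u : ℤ) • v u

theorem comb_zero (v : ι → Fin m → ℤ) : comb v 0 = 0 := by simp [comb]

theorem comb_add (v : ι → Fin m → ℤ) (μ ν : ι → ℕ) : comb v (μ + ν) = comb v μ + comb v ν := by
  simp [comb, add_smul, Finset.sum_add_distrib]

theorem comb_single [DecidableEq ι] (v : ι → Fin m → ℤ) (u : ι) :
    comb v (Pi.single u 1) = v u := by
  simp [comb, Pi.single_apply]

theorem exists_eq_single [DecidableEq ι] {μ : ι → ℕ} (h : ∑ u, μ u = 1) :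
    ∃ u, μ = Pi.single u 1 := by
  obtain ⟨u, -, hu⟩ := Finset.exists_ne_zero_of_sum_ne_zero (h ▸ one_ne_zero)
  refine ⟨u, funext fun w => ?_⟩
  rw [← Finset.add_sum_erase _ _ (Finset.mem_univ u)] at h
  have hu1 : μ u = 1 := by omega
  by_cases hw : w = u
  · simp [hw, hu1]
  · have : ∑ x ∈ Finset.univ.erase u, μ x = 0 := by omega
    simpa [hw] using (Finset.sum_eq_zero_iff.1 this) w (by simp [hw])

/-- The least number (capped at `T`) of terms of the family `v` leading from `w` to `b`. -/
noncomputable def distTo (v : ι → Fin m → ℤ) (b : Fin m → ℤ) (T : ℕ) (w : Fin m → ℤ) : ℕ :=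
  sInf ({j | ∃ μ : ι → ℕ, ∑ u, μ u = j ∧ w + comb v μ = b} ∪ {T})

theorem distTo_le_cap (v : ι → Fin m → ℤ) (b : Fin m → ℤ) (T : ℕ) (w : Fin m → ℤ) :
    distTo v b T w ≤ T := Nat.sInf_le (by simp)

theorem distTo_le {v : ι → Fin m → ℤ} {b w : Fin m → ℤ} (T : ℕ) {μ : ι → ℕ}
    (h : w + comb v μ = b) : distTo v b T w ≤ ∑ u, μ u :=
  Nat.sInf_le (Or.inl ⟨μ, rfl, h⟩)

theorem distTo_spec (v : ι → Fin m → ℤ) (b : Fin m → ℤ) (T : ℕ) (w : Fin m → ℤ) :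
    (∃ μ : ι → ℕ, ∑ u, μ u = distTo v b T w ∧ w + comb v μ = b) ∨ distTo v b T w = T := by
  have := Nat.sInf_mem (s := {j | ∃ μ : ι → ℕ, ∑ u, μ u = j ∧ w + comb v μ = b} ∪ {T})
    ⟨T, by simp⟩
  exact this

theorem distTo_le_add (v : ι → Fin m → ℤ) (b : Fin m → ℤ) (T : ℕ) (w : Fin m → ℤ) (μ : ι → ℕ) :
    distTo v b T w ≤ distTo v b T (w + comb v μ) + ∑ u, μ u := by
  rcases distTo_spec v b T (w + comb v μ) with ⟨ν, hν, h⟩ | h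
  · have := distTo_le (v := v) (b := b) (w := w) T (μ := μ + ν) (by rw [comb_add, ← add_assoc, h])
    simp only [Pi.add_apply, Finset.sum_add_distrib] at this
    omega
  · have := distTo_le_cap v b T w
    omega

open Classical in
/-- The weight (a numerator over `2 * T`) of the separating point of the truncated polaroid. -/
noncomputable def gapWeight (v : ι → Fin m → ℤ) (b : Fin m → ℤ) (T : ℕ) (w : Fin m → ℤ) : ℕ :=
  if w = 0 then 0 else if w ∈ Set.range v then 1 else 2 * T - distTo v b T w

theorem gapWeight_le (v : ι → Fin m → ℤ) (b : Fin m → ℤ) {T : ℕ} (hT : 0 < T) (w : Fin m → ℤ) :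
    gapWeight v b T w ≤ 2 * T := by
  unfold gapWeight; split_ifs <;> omega

theorem gapWeight_of_big {v : ι → Fin m → ℤ} {b : Fin m → ℤ} {T : ℕ} {w : Fin m → ℤ}
    (h0 : w ≠ 0) (hv : w ∉ Set.range v) : gapWeight v b T w = 2 * T - distTo v b T w := by
  simp only [gapWeight, h0, hv, if_false]

/-- The cap on `distTo` gives every point outside `0` and the family weight at least `T`. Two such
points already reach the maximal weight `2T`, so only sums with at most one of them need care. -/
theorem sum_gapWeight_cases (v : ι → Fin m → ℤ) (b : Fin m → ℤ) (T : ℕ) {κ : Type*}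
    (w : κ → Fin m → ℤ) (S : Finset κ) :
    2 * T ≤ ∑ i ∈ S, gapWeight v b T (w i) ∨
    (∃ μ : ι → ℕ, ∑ i ∈ S, w i = comb v μ ∧ ∑ i ∈ S, gapWeight v b T (w i) = ∑ u, μ u ∧
      ∑ u, μ u ≤ S.card) ∨
    ∃ (x : Fin m → ℤ) (μ : ι → ℕ), x ≠ 0 ∧ x ∉ Set.range v ∧ ∑ i ∈ S, w i = x + comb v μ ∧
      ∑ i ∈ S, gapWeight v b T (w i) = gapWeight v b T x + ∑ u, μ u := by
  classical
  induction S using Finset.induction_on with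
  | empty => exact Or.inr (Or.inl ⟨0, by simp [comb_zero]⟩)
  | insert a S ha ih =>
    simp only [Finset.sum_insert ha, Finset.card_insert_of_notMem ha]
    by_cases h0 : w a = 0
    · have hw : gapWeight v b T (w a) = 0 := by simp [gapWeight, h0]
      rw [hw, h0, zero_add, zero_add]
      rcases ih with h | ⟨μ, h1, h2, h3⟩ | h
      · exact Or.inl (by omega)
      · exact Or.inr (Or.inl ⟨μ, h1, by omega, by omega⟩)
      · exact Or.inr (Or.inr h)
    by_cases hv : w a ∈ Set.range v
    · have hw : gapWeight v b T (w a) = 1 := by simp only [gapWeight, h0, hv, if_false, if_true]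
      obtain ⟨u, hu⟩ := hv
      rw [hw, ← hu]
      have hs (μ : ι → ℕ) : ∑ x, (Pi.single u 1 + μ : ι → ℕ) x = 1 + ∑ x, μ x := by
        simp [Finset.sum_add_distrib]
      rcases ih with h | ⟨μ, h1, h2, h3⟩ | ⟨x, μ, hx, hxv, h1, h2⟩
      · exact Or.inl (by omega)
      · refine Or.inr (Or.inl ⟨Pi.single u 1 + μ, ?_, ?_, ?_⟩)
        · rw [comb_add, comb_single, h1]
        · rw [hs]; omega
        · rw [hs]; omega
      · refine Or.inr (Or.inr ⟨x, Pi.single u 1 + μ, hx, hxv, ?_, ?_⟩)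
        · rw [comb_add, comb_single, h1]; abel
        · rw [hs]; omega
    · have hw := gapWeight_of_big (b := b) (T := T) h0 hv
      have hc := distTo_le_cap v b T (w a)
      rcases ih with h | ⟨μ, h1, h2, h3⟩ | ⟨x, μ, hx, hxv, h1, h2⟩
      · exact Or.inl (by omega)
      · exact Or.inr (Or.inr ⟨w a, μ, h0, hv, by rw [h1], by omega⟩)
      · have hw' := gapWeight_of_big (b := b) (T := T) hx hxv
        have hc' := distTo_le_cap v b T x
        exact Or.inl (by omega)

/-- If a combination of `T` members of the family `v` equals `b`, no combination of at least two
and fewer than `T` members lies in the box, and no `b - v u` does, then fewer than `T` terms do not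
suffice. -/
theorem le_kStar_of_gap [Nonempty ι] (hN : 1 ≤ N) (v : ι → Fin m → ℤ) (b : Fin m → ℤ) (T : ℕ)
    (hv : ∀ u, v u ∈ indexBox m N) (hb : b ∈ indexBox m N) (lam : ι → ℕ)
    (hlam : ∑ u, lam u = T) (hsum : comb v lam = b)
    (hgap : ∀ μ : ι → ℕ, 2 ≤ ∑ u, μ u → ∑ u, μ u < T → comb v μ ∉ indexBox m N)
    (hbv : ∀ u, b - v u ∉ indexBox m N) : (T : ℕ∞) ≤ kStar m := by
  classical
  have hzero : (0 : Fin m → ℤ) ∈ indexBox m N := fun i => by simp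
  have hv0 : ∀ u, v u ≠ 0 := fun u h => hbv u (by simpa [h] using hb)
  have hb0 : b ≠ 0 := by
    rintro rfl
    obtain ⟨u⟩ := ‹Nonempty ι›
    exact hbv u fun i => by simpa using hv u i
  have hbr : b ∉ Set.range v := by
    rintro ⟨u, rfl⟩
    exact hbv u (by simpa using hzero)
  have hT : 0 < T := by
    rw [Nat.pos_iff_ne_zero]
    rintro rfl
    apply hb0
    rw [← hsum, show lam = 0 from funext fun u => by
      simpa using (Finset.sum_eq_zero_iff.1 hlam) u (Finset.mem_univ u), comb_zero]
  have hTR : (0 : ℝ) < 2 * T := by positivity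
  have hsmall : ∀ μ : ι → ℕ, ∑ u, μ u < T → comb v μ ∈ indexBox m N →
      comb v μ = 0 ∨ ∃ u, μ = Pi.single u 1 := by
    intro μ h1 h2
    by_cases h3 : 2 ≤ ∑ u, μ u
    · exact absurd h2 (hgap μ h3 h1)
    rcases Nat.eq_zero_or_pos (∑ u, μ u) with h | h
    · left
      rw [show μ = 0 from funext fun u => by
        simpa using (Finset.sum_eq_zero_iff.1 h) u (Finset.mem_univ u), comb_zero]
    · exact Or.inr (exists_eq_single (by omega))
  have hfb : gapWeight v b T b = 2 * T := by
    rw [gapWeight_of_big hb0 hbr]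
    have := distTo_le (v := v) (b := b) (w := b) T (μ := 0) (by rw [comb_zero, add_zero])
    simp at this
    omega
  refine le_kStar_of_forall_not_termsSuffice fun k hk hS => ?_
  let π : indexBox m N → ℝ := fun w => (gapWeight v b T w.1 : ℝ) / (2 * T)
  have hπ : π ∈ truncatedPolaroid m N ⟨b, hb⟩ k := by
    refine ⟨?_, ?_, ?_⟩
    · simp only [π, hfb]
      push_cast
      exact div_self hTR.ne'
    · rintro ⟨u, hu⟩ ⟨w, hw⟩ huw
      simp only at huw
      suffices h : gapWeight v b T u + gapWeight v b T w = 2 * T by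
        simp only [π]
        rw [← add_div, div_eq_one_iff_eq hTR.ne']
        exact_mod_cast h
      by_cases hu0 : u = 0
      · rw [hu0, zero_add] at huw
        rw [huw, hu0, hfb]; simp [gapWeight]
      by_cases hw0 : w = 0
      · rw [hw0, add_zero] at huw
        rw [huw, hw0, hfb]; simp [gapWeight]
      have huv : u ∉ Set.range v := by
        rintro ⟨x, rfl⟩
        exact hbv x (by rwa [← huw, add_sub_cancel_left])
      have hwv : w ∉ Set.range v := by
        rintro ⟨x, rfl⟩
        exact hbv x (by rwa [← huw, add_sub_cancel_right])
      -- If `x` reached `b` in fewer than `T` steps, `y` would be a short combination in the box,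
      -- hence `0` or a family member. So both distances equal the cap and the weights are `T + T`.
      have aux : ∀ x y : Fin m → ℤ, x + y = b → y ∈ indexBox m N → y ≠ 0 → y ∉ Set.range v →
          distTo v b T x = T := by
        intro x y hxy hy hy0 hyv
        rcases distTo_spec v b T x with ⟨μ, h1, h2⟩ | h
        · have hyc : comb v μ = y := by rw [← hxy] at h2; exact add_left_cancel h2
          by_contra hne
          have hlt : ∑ u, μ u < T := by
            have := distTo_le_cap v b T x
            omega
          rcases hsmall μ hlt (hyc ▸ hy) with h | ⟨z, rfl⟩
          · exact hy0 (hyc ▸ h)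
          · exact hyv ⟨z, by rw [← hyc, comb_single]⟩
        · exact h
      rw [gapWeight_of_big hu0 huv, gapWeight_of_big hw0 hwv, aux u w huw hw hw0 hwv,
        aux w u (by rw [add_comm, huw]) hu hu0 huv]
      omega
    · rintro t - htk w ⟨s, hs⟩ hsw
      simp only at hsw
      suffices h : gapWeight v b T s ≤ ∑ i, gapWeight v b T (w i).1 by
        simp only [π]
        rw [← Finset.sum_div]
        gcongr
        exact_mod_cast h
      rcases sum_gapWeight_cases v b T (fun i => (w i).1) Finset.univ with
        h | ⟨μ, h1, h2, h3⟩ | ⟨x, μ, hx, hxv, h1, h2⟩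
      · exact (gapWeight_le v b hT s).trans h
      · rw [← hsw] at h1
        simp only [Finset.card_univ, Fintype.card_fin] at h3
        rcases hsmall μ (by omega) (h1 ▸ hs) with h | ⟨u, rfl⟩
        · rw [h1, h]; simp [gapWeight]
        · rw [h2, h1, comb_single]
          simp [gapWeight, hv0]
      · rw [← hsw] at h1
        have hwx := gapWeight_of_big (b := b) (T := T) hx hxv
        have hcx := distTo_le_cap v b T x
        by_cases hs0 : s = 0
        · simp [gapWeight, hs0]
        by_cases hsv : s ∈ Set.range v
        · have : gapWeight v b T s = 1 := by simp only [gapWeight, hs0, hsv, if_false, if_true]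
          omega
        -- Adding `comb v μ` to `x` shortens the distance to `b` by at most `∑ μ`, which is exactly
        -- the weight paid for `μ`.
        · have := distTo_le_add v b T x μ
          rw [← h1] at this
          have := gapWeight_of_big (b := b) (T := T) hs0 hsv
          omega
  rw [hS N hN ⟨b, hb⟩] at hπ
  obtain ⟨w, hwsum⟩ : ∃ w : Fin T → ι, ∀ f : ι → (Fin m → ℤ), ∑ i, f (w i) =
      ∑ u, (lam u : ℤ) • f u := by
    have hcard : Fintype.card (Σ u, Fin (lam u)) = T := by simp [hlam]
    let e := Fintype.equivFinOfCardEq hcard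
    refine ⟨fun i => (e.symm i).1, fun f => ?_⟩
    rw [Equiv.sum_comp e.symm (fun x => f x.1), Fintype.sum_sigma]
    simp
  -- This constraint would read `1 ≤ T · 1 / (2T) = 1/2`.
  have := (hπ T).2.2 T hT le_rfl (fun i => ⟨v (w i), hv _⟩) ⟨b, hb⟩
    (by simp only [hwsum]; exact hsum.symm)
  have h1 : ∀ u, gapWeight v b T (v u) = 1 := fun u => by simp [gapWeight, hv0]
  simp only [π, hfb, h1] at this
  push_cast at this
  rw [Finset.sum_const, Finset.card_univ, Fintype.card_fin, div_self hTR.ne', nsmul_eq_mul,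
    mul_one_div, le_div_iff₀ hTR] at this
  have hT' : (0 : ℝ) < T := by exact_mod_cast hT
  linarith

end GapLemma

/-! ### From short relations in the box to kernels of sign matrices -/

section SignMatrix

theorem exists_ne_zero_int_kernel {ρ ι : Type*} [Fintype ρ] [Fintype ι]
    (hcard : Fintype.card ρ < Fintype.card ι) (a : ρ → ι → ℤ) :
    ∃ μ : ι → ℤ, μ ≠ 0 ∧ ∀ i, ∑ u, a i u * μ u = 0 := by
  have h : ¬ Function.Injective (Matrix.mulVecLin (Matrix.of a)) := by
    intro hinj
    have := LinearMap.finrank_le_finrank_of_injective hinj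
    simp only [Module.finrank_fintype_fun_eq_card] at this
    omega
  rw [← LinearMap.ker_eq_bot] at h
  obtain ⟨μ, hμ, h0⟩ := Submodule.exists_mem_ne_zero_of_ne_bot h
  exact ⟨μ, h0, fun i => congrFun hμ i⟩

/-- A combination of `j` terms with row sums `s` has coordinates `2Ts + j`, where `s ≡ j` mod 2. Box
radius `2T + 1` and `2 ≤ j < T` leave only `s = 0` or `s = -1`. For even `j` all `s` vanish, against
`hmin`; for odd `j` all `s` are -1, and the extra coordinate `2Ts - j` leaves the box. -/
theorem le_kStar_of_sign_relation {ρ ι : Type*} [Fintype ρ] [Nonempty ρ] [Fintype ι] [Nonempty ι]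
    {m T : ℕ} (hm : Fintype.card ρ + 1 ≤ m) (hT : 3 ≤ T) (a : ρ → ι → ℤ)
    (ha : ∀ i u, a i u = 1 ∨ a i u = -1) (lam : ι → ℕ) (hlam : ∑ u, lam u = T)
    (hker : ∀ i, ∑ u, a i u * (lam u : ℤ) = 0)
    (hmin : ∀ μ : ι → ℕ, ∑ u, μ u < T → (∀ i, ∑ u, a i u * (μ u : ℤ) = 0) → μ = 0) :
    (T : ℕ∞) ≤ kStar m := by
  classical
  obtain ⟨i₀⟩ := ‹Nonempty ρ›
  obtain ⟨e⟩ : Nonempty (Option ρ ↪ Fin m) :=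
    Function.Embedding.nonempty_of_card_le (by simpa using hm)
  -- Surplus coordinates repeat rows; only surjectivity of `φ` is needed.
  have hφ := Function.invFun_surjective e.injective
  set φ : Fin m → Option ρ := Function.invFun e
  let z : ι → Option ρ → ℤ := fun u o => o.elim (2 * T * a i₀ u - 1) fun i => 2 * T * a i u + 1
  let bz : Option ρ → ℤ := fun o => o.elim (-(T : ℤ)) fun _ => T
  have hTZ : (3 : ℤ) ≤ T := by exact_mod_cast hT
  have hcomb (μ : ι → ℕ) (c : Fin m) : comb (fun u c => z u (φ c)) μ c =
      (φ c).elim (2 * T * (∑ u, a i₀ u * (μ u : ℤ)) - ∑ u, (μ u : ℤ))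
        fun i => 2 * T * (∑ u, a i u * (μ u : ℤ)) + ∑ u, (μ u : ℤ) := by
    simp only [comb, Finset.sum_apply, Pi.smul_apply, smul_eq_mul, z]
    rcases φ c with _ | i
    · simp only [Option.elim, Finset.mul_sum, ← Finset.sum_sub_distrib]
      exact Finset.sum_congr rfl fun u _ => by ring
    · simp only [Option.elim, Finset.mul_sum, ← Finset.sum_add_distrib]
      exact Finset.sum_congr rfl fun u _ => by ring
  refine le_kStar_of_gap (N := 2 * T + 1) (by omega) (fun u c => z u (φ c)) (fun c => bz (φ c)) T
    ?_ ?_ lam hlam ?_ ?_ ?_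
  · intro u c
    simp only [z]
    rcases φ c with _ | i
    · rw [abs_le]; push_cast
      rcases ha i₀ u with h | h <;> simp only [Option.elim, h] <;> constructor <;> linarith
    · rw [abs_le]; push_cast
      rcases ha i u with h | h <;> simp only [Option.elim, h] <;> constructor <;> linarith
  · intro c
    simp only [bz]
    rw [abs_le]; push_cast
    rcases φ c with _ | i <;> simp only [Option.elim] <;> constructor <;> linarith
  · ext c
    have : ∑ u, (lam u : ℤ) = T := by exact_mod_cast hlam
    rw [hcomb]
    simp only [bz]
    rcases φ c with _ | i <;> simp [hker, this]
  · intro μ h2 hlt hbox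
    have h2' : (2 : ℤ) ≤ ∑ u, (μ u : ℤ) := by exact_mod_cast h2
    have hlt' : ∑ u, (μ u : ℤ) < T := by exact_mod_cast hlt
    have hrow (i : ρ) : |2 * (T : ℤ) * (∑ u, a i u * (μ u : ℤ)) + ∑ u, (μ u : ℤ)| ≤ 2 * T + 1 := by
      obtain ⟨c, hc⟩ := hφ (some i)
      have := hbox c
      rw [hcomb, hc] at this
      exact_mod_cast this
    have hlast : |2 * (T : ℤ) * (∑ u, a i₀ u * (μ u : ℤ)) - ∑ u, (μ u : ℤ)| ≤ 2 * T + 1 := by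
      obtain ⟨c, hc⟩ := hφ none
      have := hbox c
      rw [hcomb, hc] at this
      exact_mod_cast this
    have hpar (i : ρ) : (2 : ℤ) ∣ (∑ u, a i u * (μ u : ℤ)) - ∑ u, (μ u : ℤ) := by
      rw [← Finset.sum_sub_distrib]
      refine Finset.dvd_sum fun u _ => ?_
      rcases ha i u with h | h
      · simp [h]
      · exact ⟨-(μ u : ℤ), by rw [h]; ring⟩
    generalize hj : ∑ u, (μ u : ℤ) = j at *
    have hval (i : ρ) : ∑ u, a i u * (μ u : ℤ) = 0 ∨ ∑ u, a i u * (μ u : ℤ) = -1 := by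
      have h := abs_le.1 (hrow i)
      generalize ∑ u, a i u * (μ u : ℤ) = s at h
      have h1 : s < 1 := by by_contra hs; nlinarith
      have h3 : -2 < s := by by_contra hs; nlinarith
      omega
    by_cases hj2 : (2 : ℤ) ∣ j
    · have h0 : μ = 0 := hmin μ hlt fun i => by
        have := hpar i
        rcases hval i with h | h <;> omega
      rw [h0] at h2
      simp at h2
    · have := hpar i₀
      have h := abs_le.1 hlast
      rcases hval i₀ with h' | h'
      · omega
      · rw [h'] at h
        linarith [h.1]
  · intro u hbox
    have hrow : |(T : ℤ) - (2 * T * a i₀ u + 1)| ≤ 2 * T + 1 := by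
      obtain ⟨c, hc⟩ := hφ (some i₀)
      have := hbox c
      simp only [Pi.sub_apply, z, bz, hc] at this
      exact_mod_cast this
    have hlast : |-(T : ℤ) - (2 * T * a i₀ u - 1)| ≤ 2 * T + 1 := by
      obtain ⟨c, hc⟩ := hφ none
      have := hbox c
      simp only [Pi.sub_apply, z, bz, hc] at this
      exact_mod_cast this
    rw [abs_le] at hrow hlast
    -- For either sign, one of the two coordinates has absolute value `3T - 1`, which exceeds `2T +
    -- 1` because `T ≥ 3`.
    rcases ha i₀ u with h | h <;> rw [h] at hrow hlast <;> linarith [hrow.2, hlast.1]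

/-- A matrix of signs with fewer rows than columns all of whose nonzero integer kernel vectors have
`ℓ¹` norm at least `D` forces subadditivity constraints with at least `D` terms. -/
theorem le_kStar_of_sign_matrix {ρ ι : Type*} [Fintype ρ] [Nonempty ρ] [Fintype ι]
    {m D : ℕ} (hm : Fintype.card ρ + 1 ≤ m) (hD : 3 ≤ D) (hcard : Fintype.card ρ < Fintype.card ι)
    (a : ρ → ι → ℤ) (ha : ∀ i u, a i u = 1 ∨ a i u = -1)
    (hker : ∀ μ : ι → ℤ, μ ≠ 0 → (∀ i, ∑ u, a i u * μ u = 0) → (D : ℤ) ≤ ∑ u, |μ u|) :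
    (D : ℕ∞) ≤ kStar m := by
  classical
  have : Nonempty ι := Fintype.card_pos_iff.1 (by omega)
  let K : Set (ι → ℤ) := {μ | μ ≠ 0 ∧ ∀ i, ∑ u, a i u * μ u = 0}
  let size : (ι → ℤ) → ℕ := fun μ => ∑ u, (μ u).natAbs
  have hK : K.Nonempty := exists_ne_zero_int_kernel hcard a
  obtain ⟨ν, ⟨hν0, hν⟩, hνmin⟩ : ∃ ν ∈ K, ∀ μ ∈ K, size ν ≤ size μ :=
    ⟨Function.argminOn size K hK, Function.argminOn_mem size K hK,
      fun μ hμ => Function.argminOn_le size K hμ⟩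
  have hDν : D ≤ size ν := by
    have := hker ν hν0 hν
    simp only [Int.abs_eq_natAbs] at this
    exact_mod_cast this
  -- Flipping column signs makes the shortest kernel vector nonnegative; a shorter nonnegative
  -- relation would flip back to a shorter kernel vector.
  let ε : ι → ℤ := fun u => if 0 ≤ ν u then 1 else -1
  have hε : ∀ u, ε u = 1 ∨ ε u = -1 := fun u => by simp only [ε]; split_ifs <;> simp
  have hεν : ∀ u, ε u * ((ν u).natAbs : ℤ) = ν u := fun u => by
    simp only [ε]; split_ifs <;> omega
  refine le_trans (by exact_mod_cast hDν) (le_kStar_of_sign_relation (T := size ν) hm (hD.trans hDν)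
    (fun i u => a i u * ε u) (fun i u => ?_) (fun u => (ν u).natAbs) rfl (fun i => ?_) ?_)
  · rcases ha i u with h | h <;> rcases hε u with h' | h' <;> simp [h, h']
  · simp only [mul_assoc, hεν, hν]
  · intro μ hlt hμ
    by_contra hne
    have hmem : (fun u => ε u * (μ u : ℤ)) ∈ K := by
      refine ⟨fun h => hne (funext fun u => ?_), fun i => by simpa only [mul_assoc] using hμ i⟩
      have := congrFun h u
      rcases hε u with h' | h' <;> simpa [h'] using this
    have h := hνmin _ hmem
    have : size (fun u => ε u * (μ u : ℤ)) = ∑ u, μ u :=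
      Finset.sum_congr rfl fun u _ => by rcases hε u with h' | h' <;> simp [h']
    omega

end SignMatrix

/-! ### Walsh functions and the sign rows -/

section WalshRows

variable {κ : Type*} [DecidableEq κ]

/-- The Walsh function `u ↦ (-1) ^ |s ∩ u|`. -/
def walsh (s u : Finset κ) : ℤ := ∏ x ∈ s, if x ∈ u then -1 else 1

theorem walsh_eq_or (s u : Finset κ) : walsh s u = 1 ∨ walsh s u = -1 := by
  induction s using Finset.induction_on with
  | empty => simp [walsh]
  | insert a s ha ih =>
    simp only [walsh, Finset.prod_insert ha] at *
    split_ifs <;> rcases ih with h | h <;> simp [h]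

theorem walsh_union {s t : Finset κ} (h : Disjoint s t) (u : Finset κ) :
    walsh (s ∪ t) u = walsh s u * walsh t u := Finset.prod_union h

theorem walsh_eq_one_of_disjoint {s u : Finset κ} (h : Disjoint s u) : walsh s u = 1 :=
  Finset.prod_eq_one fun _ hx => if_neg (Finset.disjoint_left.1 h hx)

theorem sum_powerset_walsh (s u : Finset κ) :
    ∑ c ∈ s.powerset, walsh c u = if Disjoint s u then 2 ^ s.card else 0 := by
  simp only [walsh]
  rw [← Finset.prod_one_add]
  split_ifs with h
  · rw [Finset.prod_congr rfl fun x hx => by rw [if_neg (Finset.disjoint_left.1 h hx)],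
      Finset.prod_const]
    norm_num
  · obtain ⟨x, hx, hxu⟩ := Finset.not_disjoint_iff.1 h
    exact Finset.prod_eq_zero hx (by simp [hxu])

theorem sum_walsh_mul_walsh [Fintype κ] (u w : Finset κ) :
    ∑ s : Finset κ, walsh s u * walsh s w = if u = w then 2 ^ Fintype.card κ else 0 := by
  simp only [walsh, ← Finset.prod_mul_distrib]
  rw [← Finset.powerset_univ, ← Finset.prod_one_add]
  split_ifs with h
  · rw [h, Finset.prod_congr rfl fun x _ => show (1 : ℤ) + _ = 2 by split_ifs <;> norm_num]
    simp
  · obtain ⟨x, hx⟩ : ∃ x, ¬ (x ∈ u ↔ x ∈ w) := by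
      by_contra hc; push Not at hc; exact h (Finset.ext hc)
    refine Finset.prod_eq_zero (Finset.mem_univ x) ?_
    by_cases h1 : x ∈ u <;> by_cases h2 : x ∈ w <;> simp_all

variable [Fintype κ]

/-- The Walsh transform of an integer vector indexed by subsets. -/
def walshTransform (μ : Finset κ → ℤ) (s : Finset κ) : ℤ := ∑ u, walsh s u * μ u

theorem eq_zero_of_walshTransform_eq_zero {μ : Finset κ → ℤ} (h : ∀ s, walshTransform μ s = 0) :
    μ = 0 := by
  funext w
  have h1 : ∑ s, walsh s w * walshTransform μ s = 2 ^ Fintype.card κ * μ w := by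
    simp only [walshTransform, Finset.mul_sum]
    rw [Finset.sum_comm]
    simp only [← mul_assoc, ← Finset.sum_mul, sum_walsh_mul_walsh]
    simp
  simpa [h] using h1.symm

theorem abs_walshTransform_le (μ : Finset κ → ℤ) (s : Finset κ) :
    |walshTransform μ s| ≤ ∑ u, |μ u| := by
  refine (Finset.abs_sum_le_sum_abs _ _).trans (Finset.sum_le_sum fun u _ => ?_)
  rcases walsh_eq_or s u with h | h <;> simp [h]

theorem abs_sum_erase_le {β : Type*} [DecidableEq β] (S : Finset β) {c : β} (hc : c ∈ S)
    (f : β → ℤ) {M : ℤ} (h : ∀ x ∈ S, x ≠ c → 8 * |f x| ≤ M) :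
    8 * |∑ x ∈ S.erase c, f x| ≤ (S.card - 1) * M := by
  calc 8 * |∑ x ∈ S.erase c, f x| ≤ 8 * ∑ x ∈ S.erase c, |f x| := by
        gcongr; exact Finset.abs_sum_le_sum_abs _ _
    _ ≤ ∑ x ∈ S.erase c, M := by
        rw [Finset.mul_sum]
        exact Finset.sum_le_sum fun x hx => h x (Finset.mem_of_mem_erase hx)
          (Finset.ne_of_mem_erase hx)
    _ = (S.card - 1) * M := by
        rw [Finset.sum_const, Finset.card_erase_of_mem hc, nsmul_eq_mul,
          Nat.cast_sub (Finset.card_pos.2 ⟨c, hc⟩)]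
        simp

open Finset.Colex in
/-- For `p < i` in the colexicographic order there is a sign vector whose annihilator consists of
vectors whose Walsh coefficient at `i` is about `2 ^ (|i| - 1)` times the one at `p`. -/
theorem exists_sign_row [LinearOrder κ] {p i : Finset κ} (hpi : toColex p < toColex i) :
    ∃ g : Finset κ → ℤ, (∀ u, g u = 1 ∨ g u = -1) ∧
      ∀ μ : Finset κ → ℤ, ∑ u, g u * μ u = 0 →
        ∀ M : ℤ, (∀ l, toColex l < toColex i → l ≠ p → 8 * |walshTransform μ l| ≤ M) →
          8 * |walshTransform μ i - (2 ^ (i.card - 1) - 1) * walshTransform μ p| ≤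
            2 * (2 ^ (i.card - 1) - 1) * M := by
  obtain ⟨t, hti, htp, htmax⟩ := toColex_lt_toColex_iff_exists_forall_lt.1 hpi
  set d := i.erase t with hd
  have hdcard : d.card = i.card - 1 := Finset.card_erase_of_mem hti
  have htd : t ∉ d := Finset.notMem_erase t i
  have hdi : d ∪ {t} = i := by
    rw [hd]; ext x; by_cases hx : x = t <;> simp [hx, hti]
  have hlt1 : ∀ c ⊆ d, c ≠ d → toColex (c ∪ {t}) < toColex i := by
    intro c hc hne
    rw [← hdi]
    apply toColex_lt_toColex_of_ssubset
    refine Finset.ssubset_iff_subset_ne.2 ⟨Finset.union_subset_union_left hc, fun h => hne ?_⟩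
    refine hc.antisymm fun x hx => ?_
    have : x ∈ c ∪ {t} := h ▸ Finset.mem_union_left _ hx
    rcases Finset.mem_union.1 this with h | h
    · exact h
    · exact absurd hx (Finset.mem_singleton.1 h ▸ htd)
  have hlt2 : ∀ c ⊆ d, toColex (c ∪ p \ d) < toColex i := by
    intro c hc
    rw [toColex_lt_toColex_iff_exists_forall_lt]
    refine ⟨t, hti, ?_, ?_⟩
    · simp only [Finset.mem_union, Finset.mem_sdiff, htp, false_and, or_false]
      exact fun h => htd (hc h)
    · intro x hx hxi
      rcases Finset.mem_union.1 hx with h | h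
      · exact absurd (Finset.mem_of_mem_erase (hc h)) hxi
      · exact htmax x (Finset.mem_sdiff.1 h).1 hxi
  have hdisj1 : ∀ c ⊆ d, Disjoint c {t} := fun c hc =>
    Finset.disjoint_singleton_right.2 fun h => htd (hc h)
  have hdisj2 : ∀ c ⊆ d, Disjoint c (p \ d) := fun c hc =>
    Finset.disjoint_of_subset_left hc Finset.disjoint_sdiff
  have hpd : p ∩ d ∪ p \ d = p := by rw [Finset.union_comm]; exact Finset.sdiff_union_inter p d
  refine ⟨fun u => if Disjoint d u then walsh {t} u else -walsh p u, fun u => ?_, ?_⟩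
  · simp only
    split_ifs
    · exact walsh_eq_or _ _
    · rcases walsh_eq_or p u with h | h <;> simp [h]
  intro μ hμ M hM
  -- Walsh expansion of the row: `∑ c ⊆ d, walsh c` is `2^|d|` times the indicator of disjointness
  -- from `d`, and there `walsh p` agrees with `walsh (p \ d)`.
  have hexp : ∀ u, 2 ^ d.card * (if Disjoint d u then walsh {t} u else -walsh p u) =
      -(2 ^ d.card) * walsh p u + ∑ c ∈ d.powerset, (walsh (c ∪ {t}) u + walsh (c ∪ p \ d) u) := by
    intro u
    have : ∑ c ∈ d.powerset, (walsh (c ∪ {t}) u + walsh (c ∪ p \ d) u) =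
        (∑ c ∈ d.powerset, walsh c u) * (walsh {t} u + walsh (p \ d) u) := by
      rw [Finset.sum_mul]
      refine Finset.sum_congr rfl fun c hc => ?_
      have hc := Finset.mem_powerset.1 hc
      rw [walsh_union (hdisj1 c hc), walsh_union (hdisj2 c hc)]; ring
    rw [this, sum_powerset_walsh]
    split_ifs with h
    · have : walsh p u = walsh (p \ d) u := by
        conv_lhs => rw [← hpd]
        rw [walsh_union (hdisj2 _ Finset.inter_subset_right), walsh_eq_one_of_disjoint
          (Finset.disjoint_of_subset_left Finset.inter_subset_right h), one_mul]
      rw [this]; ring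
    · ring
  have hrec : ∑ c ∈ d.powerset, (walshTransform μ (c ∪ {t}) + walshTransform μ (c ∪ p \ d)) =
      2 ^ d.card * walshTransform μ p := by
    have h0 : ∑ u, (2 ^ d.card * (if Disjoint d u then walsh {t} u else -walsh p u)) * μ u = 0 := by
      simp only [mul_assoc, ← Finset.mul_sum, hμ, mul_zero]
    simp only [hexp, add_mul, Finset.sum_add_distrib, Finset.sum_mul] at h0
    simp only [Finset.sum_add_distrib, walshTransform]
    rw [Finset.sum_comm (s := d.powerset), Finset.sum_comm (s := d.powerset)]
    have h1 : ∑ u, -(2 ^ d.card) * walsh p u * μ u = -(2 ^ d.card * ∑ u, walsh p u * μ u) := by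
      rw [Finset.mul_sum, ← Finset.sum_neg_distrib]
      exact Finset.sum_congr rfl fun u _ => by ring
    rw [h1] at h0
    linarith
  have hcard : (d.powerset.card : ℤ) = 2 ^ (i.card - 1) := by
    rw [Finset.card_powerset, hdcard]; push_cast; rfl
  -- The term `c = d` of the first sum is the coefficient at `i`, and `c = p ∩ d` in the second
  -- gives the one at `p`. All remaining terms precede `i` and differ from `p`, so `hM` bounds them.
  have hA := abs_sum_erase_le d.powerset (c := d) (by simp)
    (fun c => walshTransform μ (c ∪ {t})) (M := M) fun c hc hne =>
      hM _ (hlt1 c (Finset.mem_powerset.1 hc) hne) fun h => htp (by rw [← h]; simp)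
  have hB := abs_sum_erase_le d.powerset (c := p ∩ d)
    (Finset.mem_powerset.2 Finset.inter_subset_right)
    (fun c => walshTransform μ (c ∪ p \ d)) (M := M) fun c hc hne =>
      hM _ (hlt2 c (Finset.mem_powerset.1 hc)) fun h => hne (by
        have hcd := Finset.mem_powerset.1 hc
        rw [← h]
        ext x
        have := @hcd x
        simp only [Finset.mem_inter, Finset.mem_union, Finset.mem_sdiff]
        tauto)
  rw [Finset.sum_add_distrib, ← Finset.add_sum_erase d.powerset _ (Finset.mem_powerset.2 subset_rfl),
    ← Finset.add_sum_erase (a := p ∩ d) d.powerset (fun c => walshTransform μ (c ∪ p \ d))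
      (Finset.mem_powerset.2 Finset.inter_subset_right), hpd, hdi, hdcard] at hrec
  rw [hcard] at hA hB
  generalize ∑ x ∈ d.powerset.erase d, walshTransform μ (x ∪ {t}) = A at *
  generalize ∑ x ∈ d.powerset.erase (p ∩ d), walshTransform μ (x ∪ p \ d) = B at *
  rw [show walshTransform μ i - (2 ^ (i.card - 1) - 1) * walshTransform μ p = -(A + B) by linarith,
    abs_neg]
  linarith [abs_add_le A B]

end WalshRows

/-! ### Growth of Walsh coefficients along the colexicographic order -/

section SubsetChain

open Finset.Colex

variable {κ : Type*} [LinearOrder κ] [Fintype κ]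

/-- The colexicographically largest set with at least five elements before `i` (or `∅`). -/
def prevLarge (i : Finset κ) : Finset κ :=
  ofColex ((Finset.univ.filter fun j : Finset κ => toColex j < toColex i ∧ 5 ≤ j.card).sup toColex)

theorem prevLarge_lt {i : Finset κ} (hi : i ≠ ∅) : toColex (prevLarge i) < toColex i := by
  have hbot : (⊥ : Colex (Finset κ)) < toColex i :=
    toColex_lt_toColex_of_ssubset (Finset.empty_ssubset.2 (Finset.nonempty_iff_ne_empty.2 hi))
  rw [prevLarge, toColex_ofColex, Finset.sup_lt_iff hbot]
  exact fun j hj => (Finset.mem_filter.1 hj).2.1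

theorem le_prevLarge {i l : Finset κ} (hl : toColex l < toColex i) (hc : 5 ≤ l.card) :
    toColex l ≤ toColex (prevLarge i) := by
  rw [prevLarge, toColex_ofColex]
  exact Finset.le_sup (f := toColex) (by simp [hl, hc])

theorem prevLarge_eq_empty_or (i : Finset κ) : prevLarge i = ∅ ∨ 5 ≤ (prevLarge i).card := by
  rcases Finset.eq_empty_or_nonempty
    (Finset.univ.filter fun j : Finset κ => toColex j < toColex i ∧ 5 ≤ j.card) with h | h
  · left; rw [prevLarge, h]; simp
  · right
    obtain ⟨j, hj, hjs⟩ := Finset.exists_mem_eq_sup _ h toColex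
    rw [prevLarge, hjs]
    exact (Finset.mem_filter.1 hj).2.2

theorem induction_toColex {P : Finset κ → Prop}
    (h : ∀ i, (∀ l, toColex l < toColex i → P l) → P i) (i : Finset κ) : P i := by
  have wf : WellFounded fun s t : Finset κ => toColex s < toColex t :=
    haveI : IsTrans (Finset κ) fun s t => toColex s < toColex t := ⟨fun _ _ _ => lt_trans⟩
    haveI : Std.Irrefl fun s t : Finset κ => toColex s < toColex t := ⟨fun _ => lt_irrefl _⟩
    Finite.wellFounded_of_trans_of_irrefl _
  exact wf.induction i h

/-- Taking `M = |y p|` with `p = prevLarge i`, the recursion gives `|y i| ≥ (3/4)(2^(|i|-1) - 1)|y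
p| ≥ 2^(|i|-2)|y p|`. The cutoff five makes this factor at least 8, which restores the gap of 8
needed for the next step. -/
theorem walshTransform_growth {y : Finset κ → ℤ} (h0 : y ∅ ≠ 0)
    (hsmall : ∀ i, i ≠ ∅ → i.card ≤ 4 → y i = 0)
    (hrec : ∀ i, 5 ≤ i.card → ∀ M : ℤ,
      (∀ l, toColex l < toColex i → l ≠ prevLarge i → 8 * |y l| ≤ M) →
        8 * |y i - (2 ^ (i.card - 1) - 1) * y (prevLarge i)| ≤ 2 * (2 ^ (i.card - 1) - 1) * M)
    (i : Finset κ) : i = ∅ ∨ 5 ≤ i.card →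
      ∏ j : Finset κ with toColex j ≤ toColex i ∧ 5 ≤ j.card, (2 : ℤ) ^ (j.card - 2) ≤ |y i| ∧
      ∀ l, toColex l < toColex i → 8 * |y l| ≤ |y i| := by
  induction i using induction_toColex with
  | h i ih =>
  rintro (rfl | hi)
  · refine ⟨?_, fun l hl => absurd hl (by simp)⟩
    rw [Finset.filter_false_of_mem, Finset.prod_empty]
    · exact Int.one_le_abs h0
    · rintro j - ⟨hj, hj5⟩
      rw [toColex_empty, le_bot_iff, ← toColex_empty, toColex_inj] at hj
      simp [hj] at hj5
  have hi0 : i ≠ ∅ := by rintro rfl; simp at hi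
  set p := prevLarge i with hp
  have hpi : toColex p < toColex i := prevLarge_lt hi0
  obtain ⟨hprod, hbelow⟩ := ih p hpi (prevLarge_eq_empty_or i)
  have hothers : ∀ l, toColex l < toColex i → l ≠ p → 8 * |y l| ≤ |y p| := by
    intro l hl hne
    rcases lt_trichotomy (toColex l) (toColex p) with h | h | h
    · exact hbelow l h
    · exact absurd (toColex_inj.1 h) hne
    · have hcard : l.card ≤ 4 := by
        by_contra hc
        exact absurd (le_prevLarge hl (by omega)) (not_le.2 h)
      have hl0 : l ≠ ∅ := by rintro rfl; simp at h
      rw [hsmall l hl0 hcard]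
      simp
  have hr := hrec i hi |y p| hothers
  obtain ⟨c, hc⟩ : ∃ c, i.card = c + 5 := ⟨i.card - 5, by omega⟩
  have hc1 : i.card - 1 = c + 4 := by omega
  have hc2 : i.card - 2 = c + 3 := by omega
  have hpow : (1 : ℤ) ≤ 2 ^ c := one_le_pow₀ (by norm_num)
  have hyp := abs_nonneg (y p)
  have hgrow : (2 : ℤ) ^ (i.card - 2) * |y p| ≤ |y i| := by
    rw [hc1] at hr
    rw [hc2]
    have h1 : |(2 ^ (c + 4) - 1) * y p| = (2 ^ (c + 4) - 1) * |y p| := by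
      rw [abs_mul, abs_of_nonneg]
      rw [pow_add]; linarith
    have h2 := abs_sub_abs_le_abs_sub ((2 ^ (c + 4) - 1) * y p) (y i)
    rw [abs_sub_comm, h1] at h2
    rw [pow_add] at *
    nlinarith
  have hgrow8 : 8 * |y p| ≤ |y i| := by
    refine le_trans ?_ hgrow
    rw [hc2, pow_add]
    nlinarith
  refine ⟨?_, fun l hl => ?_⟩
  · have hset : (Finset.univ.filter fun j : Finset κ => toColex j ≤ toColex i ∧ 5 ≤ j.card) =
        insert i (Finset.univ.filter fun j : Finset κ => toColex j ≤ toColex p ∧ 5 ≤ j.card) := by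
      ext j
      simp only [Finset.mem_filter, Finset.mem_univ, true_and, Finset.mem_insert]
      constructor
      · rintro ⟨h1, h2⟩
        rcases h1.eq_or_lt with h | h
        · exact Or.inl (toColex_inj.1 h)
        · exact Or.inr ⟨le_prevLarge h h2, h2⟩
      · rintro (rfl | ⟨h1, h2⟩)
        · exact ⟨le_rfl, hi⟩
        · exact ⟨h1.trans hpi.le, h2⟩
    rw [hset, Finset.prod_insert (by simp [hpi])]
    refine le_trans ?_ hgrow
    gcongr
  · by_cases hne : l = p
    · rw [hne]; exact hgrow8
    · have := hothers l hl hne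
      linarith

theorem two_mul_sum_card_finset (κ : Type*) [Fintype κ] [DecidableEq κ] :
    2 * ∑ j : Finset κ, j.card = Fintype.card κ * 2 ^ Fintype.card κ := by
  have h : ∑ j : Finset κ, j.card = ∑ j : Finset κ, jᶜ.card :=
    (Equiv.sum_comp (Equiv.ofBijective _ compl_bijective) (fun j : Finset κ => j.card)).symm
  rw [two_mul]
  nth_rw 2 [h]
  rw [← Finset.sum_add_distrib]
  simp [Finset.card_add_card_compl, mul_comm]

/-- Each `|j|` is at most 4 plus its exponent in the product (0 for small `j`). Since `∑ |j| = k
2^(k-1)`, the loss is `4 · 2^k = 8 · 2^(k-1)`. -/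
theorem two_pow_le_prod_large {k : ℕ} (hk : 8 ≤ k) :
    2 ^ ((k - 8) * 2 ^ (k - 1)) ≤
      ∏ j : Finset (Fin k) with 5 ≤ j.card, (2 : ℤ) ^ (j.card - 2) := by
  have hS : ∑ j : Finset (Fin k), j.card = (k - 8) * 2 ^ (k - 1) + 4 * 2 ^ k := by
    have := two_mul_sum_card_finset (Fin k)
    rw [Fintype.card_fin] at this
    obtain ⟨l, rfl⟩ : ∃ l, k = l + 8 := ⟨k - 8, by omega⟩
    simp only [Nat.add_sub_cancel, show l + 8 - 1 = l + 7 by omega, pow_succ] at *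
    linarith
  have h : ∏ j : Finset (Fin k), (2 : ℤ) ^ j.card ≤
      ∏ j : Finset (Fin k), (2 ^ 4 * if 5 ≤ j.card then 2 ^ (j.card - 2) else 1) := by
    refine Finset.prod_le_prod (fun j _ => by positivity) fun j _ => ?_
    split_ifs with hj
    · rw [← pow_add]; exact pow_le_pow_right₀ (by norm_num) (by omega)
    · rw [mul_one]; exact pow_le_pow_right₀ (by norm_num) (by omega)
  rw [Finset.prod_mul_distrib, ← Finset.prod_filter, Finset.prod_const, Finset.prod_pow_eq_pow_sum,
    hS, Finset.card_univ, Fintype.card_finset, Fintype.card_fin, ← pow_mul, pow_add, mul_comm] at h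
  exact le_of_mul_le_mul_left h (by positivity)

theorem le_kStar_of_two_pow_le {m k : ℕ} (hk : 9 ≤ k) (hm : 2 ^ k ≤ m) :
    ((2 ^ ((k - 8) * 2 ^ (k - 1)) : ℕ) : ℕ∞) ≤ kStar m := by
  have hrows : ∀ i : {i : Finset (Fin k) // i ≠ ∅}, ∃ g : Finset (Fin k) → ℤ,
      (∀ u, g u = 1 ∨ g u = -1) ∧ ∀ μ : Finset (Fin k) → ℤ, ∑ u, g u * μ u = 0 →
        (i.1.card ≤ 4 → walshTransform μ i.1 = 0) ∧ (5 ≤ i.1.card → ∀ M : ℤ,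
          (∀ l, toColex l < toColex i.1 → l ≠ prevLarge i.1 → 8 * |walshTransform μ l| ≤ M) →
            8 * |walshTransform μ i.1 -
              (2 ^ (i.1.card - 1) - 1) * walshTransform μ (prevLarge i.1)| ≤
                2 * (2 ^ (i.1.card - 1) - 1) * M) := by
    rintro ⟨i, hi⟩
    by_cases hc : i.card ≤ 4
    · exact ⟨walsh i, walsh_eq_or i, fun μ hμ => ⟨fun _ => hμ, fun h5 => absurd h5 (by simp only; omega)⟩⟩
    · obtain ⟨g, hg, hg'⟩ := exists_sign_row (prevLarge_lt hi)
      exact ⟨g, hg, fun μ hμ => ⟨fun h4 => absurd h4 hc, fun _ => hg' μ hμ⟩⟩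
  choose a ha hrec using hrows
  have hcard : Fintype.card {i : Finset (Fin k) // i ≠ ∅} + 1 = 2 ^ k := by
    rw [Fintype.card_subtype_compl, Fintype.card_finset, Fintype.card_fin]
    simp [Nat.sub_add_cancel Nat.one_le_two_pow]
  have : Nonempty {i : Finset (Fin k) // i ≠ ∅} :=
    ⟨{⟨0, by omega⟩}, Finset.singleton_ne_empty _⟩
  refine le_kStar_of_sign_matrix (hcard.trans_le hm) ?_
    (by rw [Fintype.card_finset, Fintype.card_fin]; omega) a ha fun μ hμ0 hμ => ?_
  · calc 3 ≤ 2 ^ 2 := by norm_num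
      _ ≤ 2 ^ ((k - 8) * 2 ^ (k - 1)) := by
        apply Nat.pow_le_pow_right (by norm_num)
        calc 2 = 1 * 2 ^ 1 := by norm_num
          _ ≤ (k - 8) * 2 ^ (k - 1) :=
            Nat.mul_le_mul (by omega) (Nat.pow_le_pow_right (by norm_num) (by omega))
  · have h4 : ∀ i : Finset (Fin k), i ≠ ∅ → i.card ≤ 4 → walshTransform μ i = 0 :=
      fun i hi hc => (hrec ⟨i, hi⟩ μ (hμ _)).1 hc
    have hne : ∀ i : Finset (Fin k), 5 ≤ i.card → i ≠ ∅ := by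
      rintro i hi rfl
      simp at hi
    have h5 := fun (i : Finset (Fin k)) (hi : 5 ≤ i.card) =>
      (hrec ⟨i, hne i hi⟩ μ (hμ _)).2 hi
    -- Otherwise the recursion with `M = 0` kills every coefficient in turn, and Walsh inversion
    -- gives `μ = 0`.
    have h0 : walshTransform μ ∅ ≠ 0 := by
      intro h0
      refine hμ0 (eq_zero_of_walshTransform_eq_zero fun i => ?_)
      induction i using induction_toColex with
      | h i ih =>
      by_cases hi0 : i = ∅
      · rw [hi0, h0]
      by_cases hi : i.card ≤ 4
      · exact h4 i hi0 hi
      · have := h5 i (by omega) 0 fun l hl _ => by simp [ih l hl]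
        rw [ih _ (prevLarge_lt hi0)] at this
        have h := abs_nonneg (walshTransform μ i)
        simp only [mul_zero, sub_zero] at this
        exact abs_eq_zero.1 (by linarith)
    have hlast := (walshTransform_growth h0 h4 h5 Finset.univ (Or.inr (by simp; omega))).1
    have htop : ∀ j : Finset (Fin k), toColex j ≤ toColex Finset.univ :=
      fun j => toColex_le_toColex_of_subset (Finset.subset_univ j)
    simp only [htop, true_and] at hlast
    push_cast
    exact (two_pow_le_prod_large (by omega)).trans (hlast.trans (abs_walshTransform_le μ _))

end SubsetChain

/-! ### From powers of two to all dimensions -/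

theorem mainTheorem4 :
    ∃ c : ℝ, 0 < c ∧ ∀ m : ℕ, 0 < m → Even m →
      ENNReal.ofReal ((c * (m : ℝ)) ^ ((m : ℝ) / 4)) ≤ ((kStar m : ℕ∞) : ℝ≥0∞) := by
  -- For `m ≤ 512` the base is at most 1 and `one_le_kStar` suffices. Beyond that, with `2^k ≤ m <
  -- 2^(k+1)`, one has `m / 512 < 2^(k-8)` and `m / 4 ≤ 2^(k-1)`.
  refine ⟨1 / 512, by norm_num, fun m hm _ => ?_⟩
  have hmR : (0 : ℝ) < m := by exact_mod_cast hm
  by_cases hsmall : m ≤ 512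
  · have h1 : (1 : ℝ≥0∞) ≤ ((kStar m : ℕ∞) : ℝ≥0∞) := by exact_mod_cast one_le_kStar hm
    refine le_trans (ENNReal.ofReal_le_one.2 ?_) h1
    have : (m : ℝ) ≤ 512 := by exact_mod_cast hsmall
    exact Real.rpow_le_one (by positivity) (by linarith) (by positivity)
  push Not at hsmall
  set k := Nat.log 2 m with hk
  have hk1 : 2 ^ k ≤ m := Nat.pow_log_le_self 2 hm.ne'
  have hk2 : m < 2 ^ (k + 1) := Nat.lt_pow_succ_log_self (by norm_num) m
  have hk9 : 9 ≤ k := by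
    by_contra h
    have : 2 ^ (k + 1) ≤ 2 ^ 9 := Nat.pow_le_pow_right (by norm_num) (by omega)
    omega
  have hcast : (((2 ^ ((k - 8) * 2 ^ (k - 1)) : ℕ) : ℕ∞) : ℝ≥0∞) ≤ ((kStar m : ℕ∞) : ℝ≥0∞) := by
    exact_mod_cast le_kStar_of_two_pow_le hk9 hk1
  refine le_trans ?_ hcast
  rw [ENat.toENNReal_coe, ← ENNReal.ofReal_natCast]
  apply ENNReal.ofReal_le_ofReal
  obtain ⟨l, hl⟩ : ∃ l, k = l + 8 := ⟨k - 8, by omega⟩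
  have hmub : (m : ℝ) < 512 * 2 ^ l := by
    have : (m : ℝ) < 2 ^ (k + 1) := by exact_mod_cast hk2
    rw [hl, pow_add, pow_add] at this
    linarith
  have hmlb : (512 : ℝ) < m := by exact_mod_cast hsmall
  have hexp : (m : ℝ) / 4 ≤ ((2 ^ (k - 1) : ℕ) : ℝ) := by
    have h2 : (2 : ℝ) ^ (k + 1) = 2 ^ (k - 1) * 4 := by
      rw [show k + 1 = (k - 1) + 2 by omega, pow_add]; norm_num
    have : (m : ℝ) < 2 ^ (k + 1) := by exact_mod_cast hk2
    push_cast
    linarith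
  calc (1 / 512 * (m : ℝ)) ^ ((m : ℝ) / 4)
      ≤ (1 / 512 * (m : ℝ)) ^ ((2 ^ (k - 1) : ℕ) : ℝ) :=
        Real.rpow_le_rpow_of_exponent_le (by linarith) hexp
    _ = (1 / 512 * (m : ℝ)) ^ (2 ^ (k - 1)) := Real.rpow_natCast _ _
    _ ≤ (2 ^ l) ^ (2 ^ (k - 1)) := by
        gcongr
        linarith
    _ = ((2 ^ ((k - 8) * 2 ^ (k - 1)) : ℕ) : ℝ) := by
        rw [← pow_mul, hl]
        push_cast
        simp
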